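/- A dynamical system is a pair $(X,f)$ with $(X,d)$ a compact metric space and $f\colon X\to X$ continuous. It is minimal if every forward orbit $\{f^n(x):n\ge 0\}$ is dense in $X$; transitive if for all nonempty open $U,V\subset X$ there is $n\ge 0$ with $f^n(U)\cap V\neq\emptyset$; weakly mixing if $(X\times X,f\times f)$ is transitive; equicontinuous if for every $\varepsilon>0$ there is $\delta>0$ such that $d(x,y)<\delta$ implies $d(f^n(x),f^n(y))<\varepsilon$ for all $n\ge 0$. The system $(X,f)$ factors onto $(Y,g)$ if there is a continuous surjection $\pi\colon X\to Y$ with $\pi\circ f=g\circ\pi$. For $A\subset\{0,1,2,\dots\}$ let $\overline d(A)=\limsup_{n\to\infty}\frac1n|A\cap\{0,\dots,n-1\}|$. A sequence $(x_i)_{i\ge0}$ in $X$ is a $\delta$-ergodic pseudo-orbit of $f$ if $\lim_{n\to\infty}\frac1n|\{0\le i<n: d(f(x_i),x_{i+1})\ge\delta\}|=0$. The system $(X,f)$ has the $\overline d$-shadowing property if for every $\varepsilon>0$ there is $\delta>0$ such that for every $\delta$-ergodic pseudo-orbit $(x_i)_{i\ge0}$ there is $z\in X$ with $\overline d(\{i\ge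 0: d(f^i(z),x_i)<\varepsilon\})>\frac12$. Theorem. (1) Every minimal dynamical system with the $\overline d$-shadowing property is weakly mixing. (2) If a dynamical system $(X,f)$ factors onto an equicontinuous minimal dynamical system $(Y,g)$ with at least two points, then $(X,f)$ does not have the $\overline d$-shadowing property. -/

import Mathlib

open Filter Topology

namespace ShadowingDynamics

/-- The upper density `limsup_n (1/n) |A ∩ {0, …, n-1}|` of a set of nonnegative integers. -/
noncomputable def upperDensity (A : Set ℕ) : ℝ :=
  limsup (fun n : ℕ => ((A ∩ Set.Iio n).ncard : ℝ) / (n : ℝ)) atTop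

/-- `ξ` is a `δ`-ergodic pseudo-orbit of `f`: the set of times `i` with
`d (f (ξ i)) (ξ (i + 1)) ≥ δ` has density zero. -/
def IsErgodicPseudoOrbit {X : Type*} [MetricSpace X] (f : X → X) (δ : ℝ) (ξ : ℕ → X) : Prop :=
  Tendsto
    (fun n : ℕ =>
      (({i : ℕ | δ ≤ dist (f (ξ i)) (ξ (i + 1))} ∩ Set.Iio n).ncard : ℝ) / (n : ℝ))
    atTop (𝓝 0)

/-- The set of times at which the orbit of `z` under `f` is `ε`-close to the sequence `ξ`. -/
def tracingTimes {X : Type*} [MetricSpace X] (f : X → X) (z : X) (ξ : ℕ → X) (ε : ℝ) : Set ℕ :=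
  {i : ℕ | dist (f^[i] z) (ξ i) < ε}

/-- The (ergodic) shadowing property along a family `F` of sets of nonnegative integers. -/
def HasFamilyShadowing {X : Type*} [MetricSpace X] (F : Set (Set ℕ)) (f : X → X) : Prop :=
  ∀ ε : ℝ, 0 < ε → ∃ δ : ℝ, 0 < δ ∧ ∀ ξ : ℕ → X, IsErgodicPseudoOrbit f δ ξ →
    ∃ z : X, tracingTimes f z ξ ε ∈ F

/-- The upper density shadowing property: shadowing along the family of sets of upper density
strictly larger than `1/2`. -/
def HasUpperDensityShadowing {X : Type*} [MetricSpace X] (f : X → X) : Prop :=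
  HasFamilyShadowing {A : Set ℕ | 1 / 2 < upperDensity A} f

/-- `f` is minimal: every forward orbit `{f^n x : n ≥ 0}` is dense. -/
def IsMinimalMap {X : Type*} [TopologicalSpace X] (f : X → X) : Prop :=
  ∀ x : X, Dense (Set.range fun n : ℕ => f^[n] x)

/-- `f` is (topologically) transitive: for nonempty open `U`, `V` some `f^n U` with `n ≥ 0`
meets `V`. -/
def IsTransitiveMap {X : Type*} [TopologicalSpace X] (f : X → X) : Prop :=
  ∀ U V : Set X, IsOpen U → U.Nonempty → IsOpen V → V.Nonempty →
    ∃ n : ℕ, (f^[n] '' U ∩ V).Nonempty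

/-- `f` is weakly mixing: `f × f` is transitive on `X × X`. -/
def IsWeaklyMixingMap {X : Type*} [TopologicalSpace X] (f : X → X) : Prop :=
  IsTransitiveMap (Prod.map f f)

/-- `f` is equicontinuous: for every `ε > 0` there is `δ > 0` such that `d x y < δ` implies
`d (f^n x) (f^n y) < ε` for all `n ≥ 0`. -/
def IsEquicontinuousMap {X : Type*} [MetricSpace X] (f : X → X) : Prop :=
  ∀ ε : ℝ, 0 < ε → ∃ δ : ℝ, 0 < δ ∧ ∀ x y : X, dist x y < δ →
    ∀ n : ℕ, dist (f^[n] x) (f^[n] y) < ε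

/-- `(Y, g)` is a factor of `(X, f)`: there is a continuous surjection `π : X → Y` with
`π ∘ f = g ∘ π`. -/
def IsFactorOf {X Y : Type*} [TopologicalSpace X] [TopologicalSpace Y]
    (g : Y → Y) (f : X → X) : Prop :=
  ∃ π : X → Y, Continuous π ∧ Function.Surjective π ∧ Function.Semiconj π f g

end ShadowingDynamics

namespace ShadowingDynamics

/-! ### Densities of square-root blocks -/

section Density

/-! Fix a point `a` and a shift `p`; follow the orbit of `a` while `⌊√i⌋` is even and that of `f^p
a` while it is odd. Switches are so rare that this is a `δ`-ergodic pseudo-orbit for every `δ`, yet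
each parity has density `1/2`. If `γ`-close points are eventually `ε`-apart once one of them is
shifted by `p`, a point tracing one parity once can no longer trace the other later, so shadowing
fails (`not_hasUpperDensityShadowing_of_separated_shift`). For (2), take `p = 1`: `g` moves all
points by at least some `c > 0`, and equicontinuity keeps close points close. For (1), the criterion
forces orbits from any two open sets to come close at a common time; minimality then carries the
close pair to any prescribed target. -/

/-- The block where `√i` rounds down to `m` has `2m + 1` elements; summing every other block gives
the formulas. -/
theorem two_mul_count_sqrt_mod_two {e : ℕ} (he : e < 2) (n : ℕ) :
    (Nat.sqrt n % 2 = e →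
      2 * Nat.count (fun i => Nat.sqrt i % 2 = e) n + Nat.sqrt n + Nat.sqrt n * Nat.sqrt n
        = 2 * n) ∧
    (Nat.sqrt n % 2 ≠ e →
      2 * Nat.count (fun i => Nat.sqrt i % 2 = e) n = Nat.sqrt n * Nat.sqrt n + Nat.sqrt n) := by
  induction n with
  | zero => simp
  | succ n ih =>
    rw [Nat.count_succ]
    have h1 := Nat.lt_succ_sqrt n
    have h2 := Nat.sqrt_le (n + 1)
    have h3 : Nat.sqrt n ≤ Nat.sqrt (n + 1) := Nat.sqrt_le_sqrt (Nat.le_succ n)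
    have h4 : Nat.sqrt (n + 1) ≤ Nat.sqrt n + 1 := Nat.sqrt_succ_le_succ_sqrt n
    generalize Nat.count (fun i => Nat.sqrt i % 2 = e) n = c at *
    generalize Nat.sqrt (n + 1) = m' at *
    generalize Nat.sqrt n = m at *
    obtain rfl | rfl : m' = m ∨ m' = m + 1 := by omega
    · split_ifs with h
      · have := ih.1 h
        exact ⟨fun _ => by omega, fun h' => absurd h h'⟩
      · have := ih.2 h
        exact ⟨fun h' => absurd h' h, fun _ => by omega⟩
    · simp only [Nat.succ_eq_add_one] at h1
      have hn : n + 1 = (m + 1) * (m + 1) := by omega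
      have hs : (m + 1) * (m + 1) = m * m + 2 * m + 1 := by ring
      rw [hs] at hn ⊢
      split_ifs with h
      · have := ih.1 h
        exact ⟨fun h' => by omega, fun h' => by omega⟩
      · have := ih.2 h
        exact ⟨fun h' => by omega, fun h' => by omega⟩

theorem two_mul_count_sqrt_mod_two_le {e : ℕ} (he : e < 2) (n : ℕ) :
    2 * Nat.count (fun i => Nat.sqrt i % 2 = e) n ≤ n + Nat.sqrt n := by
  have h := two_mul_count_sqrt_mod_two he n
  have h1 := Nat.sqrt_le n
  have h2 := Nat.sqrt_le_add n
  by_cases hn : Nat.sqrt n % 2 = e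
  · have := h.1 hn
    omega
  · have := h.2 hn
    omega

theorem tendsto_natSqrt_div_atTop :
    Tendsto (fun n : ℕ => (Nat.sqrt n : ℝ) / (n : ℝ)) atTop (𝓝 0) := by
  have h : Tendsto (fun n : ℕ => (Real.sqrt (n : ℝ))⁻¹) atTop (𝓝 0) :=
    (Real.tendsto_sqrt_atTop.comp tendsto_natCast_atTop_atTop).inv_tendsto_atTop
  refine squeeze_zero (fun n => by positivity) (fun n => ?_) h
  rw [← Real.sqrt_div_self]
  exact div_le_div_of_nonneg_right Real.nat_sqrt_le_real_sqrt (Nat.cast_nonneg n)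

theorem upperDensity_le_half_of_sqrt_mod_two {T : Set ℕ} {e N : ℕ} (he : e < 2)
    (hT : ∀ i ∈ T, N ≤ i → Nat.sqrt i % 2 = e) : upperDensity T ≤ 1 / 2 := by
  have hcard : ∀ n : ℕ, (T ∩ Set.Iio n).ncard ≤
      N + Nat.count (fun i => Nat.sqrt i % 2 = e) n := by
    intro n
    rw [Nat.count_eq_card_filter_range]
    have hsub : T ∩ Set.Iio n ⊆
        ((Finset.range N ∪ (Finset.range n).filter fun i => Nat.sqrt i % 2 = e : Finset ℕ) :
          Set ℕ) := by
      rintro i ⟨hi, hin⟩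
      have := hT i hi
      simp only [Set.mem_Iio] at hin
      simp only [Finset.coe_union, Finset.coe_range, Finset.coe_filter, Finset.mem_range,
        Set.mem_union, Set.mem_Iio, Set.mem_ofPred_eq]
      by_cases hN : i < N
      · exact Or.inl hN
      · exact Or.inr ⟨hin, this (not_lt.mp hN)⟩
    calc (T ∩ Set.Iio n).ncard ≤ _ := Set.ncard_le_ncard hsub (Finset.finite_toSet _)
      _ = _ := Set.ncard_coe_finset _
      _ ≤ _ := (Finset.card_union_le _ _).trans_eq (by rw [Finset.card_range])
  have hlim : Tendsto (fun n : ℕ => (N : ℝ) / n + (1 / 2 + (Nat.sqrt n : ℝ) / n / 2)) atTop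
      (𝓝 (1 / 2)) := by
    have h := (tendsto_const_div_atTop_nhds_zero_nat (N : ℝ)).add
      ((tendsto_natSqrt_div_atTop.div_const 2).const_add (1 / 2))
    rwa [zero_div, add_zero, zero_add] at h
  rw [← hlim.limsup_eq]
  refine limsup_le_limsup ?_ ?_ hlim.isBoundedUnder_le
  · filter_upwards [eventually_gt_atTop 0] with n hn
    have hn' : (0 : ℝ) < n := Nat.cast_pos.mpr hn
    have h : 2 * (T ∩ Set.Iio n).ncard ≤ 2 * N + n + Nat.sqrt n := by
      have := hcard n
      have := two_mul_count_sqrt_mod_two_le he n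
      omega
    have h' : 2 * ((T ∩ Set.Iio n).ncard : ℝ) ≤ 2 * N + n + Nat.sqrt n := by exact_mod_cast h
    rw [div_le_iff₀ hn']
    field_simp
    linarith
  · exact (isBoundedUnder_of ⟨0, fun n => by positivity⟩ :
      IsBoundedUnder (· ≥ ·) atTop _).isCoboundedUnder_le

theorem tendsto_ncard_div_of_sqrt_succ_ne {B : Set ℕ}
    (hB : ∀ i ∈ B, Nat.sqrt (i + 1) ≠ Nat.sqrt i) :
    Tendsto (fun n : ℕ => ((B ∩ Set.Iio n).ncard : ℝ) / (n : ℝ)) atTop (𝓝 0) := by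
  refine squeeze_zero (fun n => by positivity) (fun n => ?_) tendsto_natSqrt_div_atTop
  refine div_le_div_of_nonneg_right ?_ (Nat.cast_nonneg n)
  have hcard : (B ∩ Set.Iio n).ncard ≤ (Set.Ioc 0 (Nat.sqrt n)).ncard := by
    refine Set.ncard_le_ncard_of_injOn (fun i => Nat.sqrt (i + 1)) ?_ ?_ (Set.finite_Ioc _ _)
    · rintro i ⟨-, hin⟩
      exact ⟨Nat.sqrt_pos.2 (Nat.succ_pos i), Nat.sqrt_le_sqrt hin⟩
    · have hmono : ∀ i ∈ B, ∀ j, j < i → Nat.sqrt (j + 1) < Nat.sqrt (i + 1) := by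
        intro i hi j hji
        have h1 : Nat.sqrt (j + 1) ≤ Nat.sqrt i := Nat.sqrt_le_sqrt hji
        have h2 : Nat.sqrt i ≤ Nat.sqrt (i + 1) := Nat.sqrt_le_sqrt (Nat.le_succ i)
        have := hB i hi
        omega
      rintro i ⟨hi, -⟩ j ⟨hj, -⟩ hij
      rcases lt_trichotomy i j with h | h | h
      · exact absurd hij (hmono j hj i h).ne
      · exact h
      · exact absurd hij (hmono i hi j h).ne'
  rw [← Finset.coe_Ioc, Set.ncard_coe_finset, Nat.card_Ioc, Nat.sub_zero] at hcard
  exact_mod_cast hcard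

end Density

/-! ### The obstruction to shadowing -/

section Shadowing

variable {X : Type*} [MetricSpace X] {f : X → X}

/-- If nearby points `u`, `v` always have `f^n u` and `f^(n+p) v` uniformly apart for large `n`,
then no point traces, on a set of upper density above `1/2`, a sequence switching between the
orbit of `a` and the orbit of `f^p a`. -/
theorem not_hasUpperDensityShadowing_of_separated_shift [Nonempty X] {p K : ℕ} {γ ε : ℝ}
    (hγ : 0 < γ) (hε : 0 < ε)
    (hsep : ∀ u v : X, dist u v < γ → ∀ n, K ≤ n → ε ≤ dist (f^[n] u) (f^[n + p] v)) :
    ¬ HasUpperDensityShadowing f := by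
  intro hf
  obtain ⟨a⟩ := ‹Nonempty X›
  obtain ⟨δ, hδ, hshadow⟩ := hf (min γ ε) (lt_min hγ hε)
  let ξ : ℕ → X := fun i => f^[i + p * (Nat.sqrt i % 2)] a
  have hξ : IsErgodicPseudoOrbit f δ ξ := by
    refine tendsto_ncard_div_of_sqrt_succ_ne fun i hi heq => ?_
    have hstep : f (ξ i) = ξ (i + 1) := by
      simp only [ξ, heq, ← Function.iterate_succ_apply' f]
      congr 2
      omega
    rw [Set.mem_ofPred_eq, hstep, dist_self] at hi
    linarith
  obtain ⟨z, hz⟩ := hshadow ξ hξ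
  refine absurd (show 1 / 2 < upperDensity (tracingTimes f z ξ (min γ ε)) from hz) (not_lt.2 ?_)
  by_cases hT : ∃ i ∈ tracingTimes f z ξ (min γ ε), True
  swap
  · exact upperDensity_le_half_of_sqrt_mod_two (e := 0) (N := 0) two_pos
      fun i hi => absurd ⟨i, hi, trivial⟩ hT
  obtain ⟨i, hi, -⟩ := hT
  -- One hit at time `i` fixes the parity of all late hits. The extra `p` pays for the odd case,
  -- where `z` and `a` exchange roles in `hsep` and `p` units of time are lost.
  refine upperDensity_le_half_of_sqrt_mod_two (e := Nat.sqrt i % 2) (N := i + K + p)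
    (Nat.mod_lt _ two_pos) fun j hj hij => ?_
  have hi' : dist (f^[i] z) (ξ i) < γ := lt_of_lt_of_le hi (min_le_left _ _)
  have hj' : dist (f^[j] z) (ξ j) < ε := lt_of_lt_of_le hj (min_le_right _ _)
  by_contra hne
  rcases Nat.mod_two_eq_zero_or_one (Nat.sqrt i) with hi2 | hi2
  · have hj2 : Nat.sqrt j % 2 = 1 := by omega
    simp only [ξ, hi2, hj2, mul_zero, mul_one, add_zero] at hi' hj'
    have h := hsep _ _ hi' (j - i) (by omega)
    rw [← Function.iterate_add_apply, ← Function.iterate_add_apply,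
      show j - i + i = j by omega, show j - i + p + i = j + p by omega] at h
    linarith
  · have hj2 : Nat.sqrt j % 2 = 0 := by omega
    simp only [ξ, hi2, hj2, mul_zero, mul_one, add_zero] at hi' hj'
    rw [dist_comm] at hi' hj'
    have h := hsep _ _ hi' (j - i - p) (by omega)
    rw [← Function.iterate_add_apply, ← Function.iterate_add_apply,
      show j - i - p + (i + p) = j by omega, show j - i - p + p + i = j by omega] at h
    linarith

end Shadowing

/-! ### Minimal systems and weak mixing -/

section Minimal

variable {X : Type*} [MetricSpace X] [CompactSpace X] {f : X → X}

theorem IsMinimalMap.exists_iterate_mem {X : Type*} [TopologicalSpace X] {f : X → X}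
    (hmin : IsMinimalMap f) {W : Set X}
    (hW : IsOpen W) (hW' : W.Nonempty) (x : X) : ∃ n : ℕ, f^[n] x ∈ W := by
  obtain ⟨_, hy, n, rfl⟩ := (hmin x).inter_open_nonempty W hW hW'
  exact ⟨n, hy⟩

theorem IsMinimalMap.surjective (hf : Continuous f) (hmin : IsMinimalMap f) :
    Function.Surjective f := by
  intro y
  have hd : Dense (Set.range f) := (hmin (f y)).mono <| by
    rintro _ ⟨n, rfl⟩
    exact ⟨f^[n] y, by rw [← Function.iterate_succ_apply' f, Function.iterate_succ_apply]⟩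
  rw [← Set.mem_range, ← (isCompact_range hf).isClosed.closure_eq, hd.closure_eq]
  exact Set.mem_univ y

/-- In a minimal system, nearby points enter a given open set simultaneously within a bounded
time. -/
theorem IsMinimalMap.exists_simultaneous_entrance (hf : Continuous f) (hmin : IsMinimalMap f)
    {W : Set X} (hW : IsOpen W) (hW' : W.Nonempty) :
    ∃ γ : ℝ, 0 < γ ∧ ∃ K : ℕ, ∀ u v : X, dist u v < γ → ∃ k ≤ K, f^[k] u ∈ W ∧ f^[k] v ∈ W := by
  have hopen : ∀ n : ℕ, IsOpen (f^[n] ⁻¹' W) := fun n => hW.preimage (hf.iterate n)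
  obtain ⟨t, ht⟩ := isCompact_univ.elim_finite_subcover (fun n : ℕ => f^[n] ⁻¹' W) hopen
    fun x _ => Set.mem_iUnion.2 (hmin.exists_iterate_mem hW hW' x)
  obtain ⟨γ, hγ, hball⟩ := lebesgue_number_lemma_of_metric
    (c := fun n : t => f^[(n : ℕ)] ⁻¹' W) isCompact_univ (fun n => hopen n) fun x hx => by
      obtain ⟨n, hn, hxn⟩ := Set.mem_iUnion₂.1 (ht hx)
      exact Set.mem_iUnion.2 ⟨⟨n, hn⟩, hxn⟩
  refine ⟨γ, hγ, t.sup id, fun u v huv => ?_⟩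
  obtain ⟨n, hn⟩ := hball u (Set.mem_univ u)
  exact ⟨n, Finset.le_sup (f := id) n.2, hn (Metric.mem_ball_self hγ),
    hn (Metric.mem_ball'.2 huv)⟩

/-- In a minimal system with upper density shadowing, any two open sets contain points whose
orbits come arbitrarily close at a common time. -/
theorem HasUpperDensityShadowing.exists_dist_iterate_lt (hf : Continuous f)
    (hmin : IsMinimalMap f) (hsh : HasUpperDensityShadowing f) {U V : Set X}
    (hU : IsOpen U) (hU' : U.Nonempty) (hV : IsOpen V) (hV' : V.Nonempty) {ε : ℝ} (hε : 0 < ε) :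
    ∃ u ∈ U, ∃ v ∈ V, ∃ n : ℕ, dist (f^[n] u) (f^[n] v) < ε := by
  by_contra! hfar
  obtain ⟨a, ha⟩ := hU'
  obtain ⟨p, hp⟩ := hmin.exists_iterate_mem hV hV' a
  obtain ⟨γ, hγ, K, hK⟩ := hmin.exists_simultaneous_entrance hf
    (hU.inter (hV.preimage (hf.iterate p))) ⟨a, ha, hp⟩
  have : Nonempty X := ⟨a⟩
  refine not_hasUpperDensityShadowing_of_separated_shift (p := p) (K := K) hγ hε
    (fun u v huv n hn => ?_) hsh
  -- At time `k` the first orbit is in `U` and the second, `p` steps later, in `V`; `hfar` separates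
  -- them from then on.
  obtain ⟨k, hk, hu, hv⟩ := hK u v huv
  have h := hfar _ hu.1 _ hv.2 (n - k)
  rwa [← Function.iterate_add_apply, ← Function.iterate_add_apply, ← Function.iterate_add_apply,
    show n - k + k = n by omega, show n - k + p + k = n + p by omega] at h

theorem HasUpperDensityShadowing.isWeaklyMixingMap (hf : Continuous f)
    (hmin : IsMinimalMap f) (hsh : HasUpperDensityShadowing f) : IsWeaklyMixingMap f := by
  rintro U V hU ⟨⟨u₁, u₂⟩, hu⟩ hV ⟨⟨v₁, v₂⟩, hv⟩
  obtain ⟨U₁, U₂, hU₁, hU₂, hu₁, hu₂, hUsub⟩ := isOpen_prod_iff.1 hU u₁ u₂ hu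
  obtain ⟨V₁, V₂, hV₁, hV₂, hv₁, hv₂, hVsub⟩ := isOpen_prod_iff.1 hV v₁ v₂ hv
  -- Delaying the second coordinate by `k` turns the target `V₁ × V₂` into the single open set `V₁ ∩
  -- f^{-k} V₂`, which a close pair enters simultaneously. The second start `f^k y` must lie in
  -- `U₂`, and surjectivity makes `f^{-k} U₂` nonempty.
  obtain ⟨k, hk⟩ := hmin.exists_iterate_mem hV₂ ⟨v₂, hv₂⟩ v₁
  obtain ⟨γ, hγ, K, hK⟩ := hmin.exists_simultaneous_entrance hf
    (hV₁.inter (hV₂.preimage (hf.iterate k))) ⟨v₁, hv₁, hk⟩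
  obtain ⟨y₀, hy₀⟩ := (hmin.surjective hf).iterate k u₂
  obtain ⟨x, hx, y, hy, n, hn⟩ := hsh.exists_dist_iterate_lt hf hmin hU₁ ⟨u₁, hu₁⟩
    (hU₂.preimage (hf.iterate k)) ⟨y₀, by rwa [Set.mem_preimage, hy₀]⟩ hγ
  obtain ⟨m, -, hxm, hym⟩ := hK _ _ hn
  refine ⟨m + n, (f^[m + n] x, f^[m + n] (f^[k] y)), ⟨(x, f^[k] y), hUsub ⟨hx, hy⟩, ?_⟩,
    hVsub ⟨?_, ?_⟩⟩
  · rw [Prod.map_iterate]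
    rfl
  · simpa only [Function.iterate_add_apply] using hxm.1
  · have h := hym.2
    rw [Set.mem_preimage, ← Function.iterate_add_apply, ← Function.iterate_add_apply] at h
    rwa [← Function.iterate_add_apply, add_comm (m + n) k, ← add_assoc]

theorem IsMinimalMap.exists_pos_le_dist_self [Nontrivial X] (hf : Continuous f)
    (hmin : IsMinimalMap f) : ∃ c : ℝ, 0 < c ∧ ∀ x : X, c ≤ dist x (f x) := by
  obtain ⟨x₀, -, hx₀⟩ := isCompact_univ.exists_isMinOn (Set.univ_nonempty (α := X))
    (continuous_id.dist hf).continuousOn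
  refine ⟨dist x₀ (f x₀), dist_pos.2 fun hfix => ?_, fun x => hx₀ (Set.mem_univ x)⟩
  obtain ⟨y, hy⟩ := exists_ne x₀
  obtain ⟨n, hn⟩ := hmin.exists_iterate_mem isOpen_compl_singleton ⟨y, hy⟩ x₀
  exact hn (Function.iterate_fixed hfix.symm n)

end Minimal

/-! ### Equicontinuous factors -/

section Factor

variable {X Y : Type*} [MetricSpace X] [CompactSpace X] [MetricSpace Y] [CompactSpace Y]
  {f : X → X} {g : Y → Y}

theorem IsFactorOf.not_hasUpperDensityShadowing [Nontrivial Y] (hg : Continuous g)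
    (hequi : IsEquicontinuousMap g) (hmin : IsMinimalMap g) (hfac : IsFactorOf g f) :
    ¬ HasUpperDensityShadowing f := by
  obtain ⟨π, hπ, hsurj, hsemi⟩ := hfac
  obtain ⟨c, hc, hdist⟩ := hmin.exists_pos_le_dist_self hg
  obtain ⟨η, hη, hgη⟩ := hequi (c / 2) (half_pos hc)
  have hunif := Metric.uniformContinuous_iff.1 (CompactSpace.uniformContinuous_of_continuous hπ)
  obtain ⟨γ, hγ, hπγ⟩ := hunif η hη
  obtain ⟨ε, hε, hπε⟩ := hunif (c / 2) (half_pos hc)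
  have : Nonempty X := hsurj.nonempty
  refine not_hasUpperDensityShadowing_of_separated_shift (p := 1) (K := 0) hγ hε
    fun u v huv n _ => ?_
  by_contra! hlt
  have h1 := hπε hlt
  rw [(hsemi.iterate_right n).eq, (hsemi.iterate_right (n + 1)).eq,
    Function.iterate_succ_apply'] at h1
  have h2 := hgη _ _ (hπγ huv) n
  have h3 := hdist (g^[n] (π v))
  have h4 := dist_triangle_left (g^[n] (π v)) (g (g^[n] (π v))) (g^[n] (π u))
  linarith

end Factor

end ShadowingDynamics

theorem theorem8p10 :
    (∀ (X : Type*) [MetricSpace X] [CompactSpace X] (f : X → X), Continuous f →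
      ShadowingDynamics.IsMinimalMap f →
      ShadowingDynamics.HasUpperDensityShadowing f →
      ShadowingDynamics.IsWeaklyMixingMap f) ∧
    (∀ (X Y : Type*) [MetricSpace X] [CompactSpace X] [MetricSpace Y] [CompactSpace Y]
      (f : X → X) (g : Y → Y), Continuous f → Continuous g →
      Nontrivial Y →
      ShadowingDynamics.IsEquicontinuousMap g →
      ShadowingDynamics.IsMinimalMap g →
      ShadowingDynamics.IsFactorOf g f →
      ¬ ShadowingDynamics.HasUpperDensityShadowing f) := by

  refine ⟨fun X _ _ f hf hmin hsh => hsh.isWeaklyMixingMap hf hmin, ?_⟩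
  intro X Y _ _ _ _ f g _ hg _ hequi hmin hfac
  exact hfac.not_hasUpperDensityShadowing hg hequi hmin
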